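/- **Theorem (The Dual Ramsey Theorem for Permutations).** A *finite permutation* is a triple $(A,<,\sqsubset)$ where $A$ is a finite set and $<$, $\sqsubset$ are linear orders on $A$. A surjection $f:A\to B$ between finite linearly ordered sets $(A,<)$ and $(B,<)$ is *rigid* if $\min f^{-1}(b)<\min f^{-1}(b')$ for all $b<b'$ in $B$. A *quotient map* $f:(A,<,\sqsubset)\to(B,<,\sqsubset)$ between finite permutations is a surjection $f:A\to B$ that is a rigid surjection $(A,<)\to(B,<)$ as well as a rigid surjection $(A,\sqsubset)\to(B,\sqsubset)$. Let $\mathbf{Perm}_{\mathit{quo}}$ be the category whose objects are the finite permutations and whose morphisms are the quotient maps, with the usual composition of maps. A category $\mathbf{C}$ has the *Ramsey property* if for every integer $k\ge 2$ and all objects $\mathcal{A},\mathcal{B}$ of $\mathbf{C}$ there is an object $\mathcal{C}$ of $\mathbf{C}$ such that for every partition $\hom_{\mathbf{C}}(\mathcal{A},\mathcal{C})=\Sigma_1\cup\dots\cup\Sigma_k$ into pairwise disjoint (possibly empty) sets there are an $i\in\{1,\dots,k\}$ and a morphism $w\in\hom_{\mathbf{C}}(\mathcal{B},\mathcal{C})$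 with $w\cdot\hom_{\mathbf{C}}(\mathcal{A},\mathcal{B})\subseteq\Sigma_i$. A category has the *dual Ramsey property* if its opposite category has the Ramsey property. Then the category $\mathbf{Perm}_{\mathit{quo}}$ has the dual Ramsey property. -/

import Mathlib

open CategoryTheory

universe u v

/-- `Σ₁ ∪ … ∪ Σ_k = S` with pairwise disjoint pieces (possibly empty): a `k`-coloring of the type
`S`. -/
def IsColoring {S : Type v} (k : ℕ) (P : Fin k → Set S) : Prop :=
  (⋃ i, P i) = Set.univ ∧ ∀ i j, i ≠ j → P i ∩ P j = ∅

/-- The arrow relation `Z ⟶ (Y)^X_k` in a category: for every `k`-coloring of `hom(X, Z)` there are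
a color `i` and a morphism `w : Y ⟶ Z` such that `w · hom(X, Y) ⊆ Σ_i`
(Mathlib writes the composite `w · f` as `f ≫ w`). -/
def RamseyArrow {C : Type u} [Category.{v} C] (k : ℕ) (X Y Z : C) : Prop :=
  ∀ P : Fin k → Set (X ⟶ Z), IsColoring k P →
    ∃ (i : Fin k) (w : Y ⟶ Z), Set.range (fun f : X ⟶ Y => f ≫ w) ⊆ P i

/-- The Ramsey property of a category. -/
def HasRamseyProperty (C : Type u) [Category.{v} C] : Prop :=
  ∀ k : ℕ, 2 ≤ k → ∀ X Y : C, ∃ Z : C, RamseyArrow k X Y Z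

/-- The dual Ramsey property of a category: the opposite category has the Ramsey property. -/
def HasDualRamseyProperty (C : Type u) [Category.{v} C] : Prop :=
  HasRamseyProperty Cᵒᵖ

/-- A rigid surjection between finite chains: a surjection `f` with
`min f⁻¹(b) < min f⁻¹(b')` whenever `b < b'`. -/
structure IsRigidSurjection {A B : Type u} [Finite A] [Finite B]
    (ordA : LinearOrder A) (ordB : LinearOrder B) (f : A → B) : Prop where
  surjective : Function.Surjective f
  min_lt_min : ∀ (b b' : B) (a a' : A), b < b' →
    IsLeast (f ⁻¹' {b}) a → IsLeast (f ⁻¹' {b'}) a' → a < a'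

namespace IsRigidSurjection

theorem id {A : Type u} [Finite A] (ordA : LinearOrder A) :
    IsRigidSurjection ordA ordA (fun x : A => x) where
  surjective := Function.surjective_id
  min_lt_min := by
    intro b b' a a' h ha ha'
    have h1 : a = b := ha.1
    have h2 : a' = b' := ha'.1
    rw [h1, h2]
    exact h

theorem exists_isLeast {A B : Type u} [Finite A] [LinearOrder A] {f : A → B}
    (hf : Function.Surjective f) (b : B) : ∃ a, IsLeast (f ⁻¹' {b}) a := by
  obtain ⟨a₀, h₀⟩ := hf b
  obtain ⟨a, ha, hmin⟩ := Set.exists_min_image (f ⁻¹' {b}) (fun x : A => x)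
    (Set.toFinite _) ⟨a₀, h₀⟩
  exact ⟨a, ha, fun x hx => hmin x hx⟩

/-- The least preimage of `c` under `g ∘ f` is the least `f`-preimage of the least `g`-preimage
of `c`. -/
theorem isLeast_of_comp {A B C : Type u} [Finite A] [Finite B]
    {ordA : LinearOrder A} {ordB : LinearOrder B}
    {f : A → B} {g : B → C} (hf : IsRigidSurjection ordA ordB f)
    {c : C} {a : A} {b : B} (ha : IsLeast ((fun x => g (f x)) ⁻¹' {c}) a)
    (hb : IsLeast (g ⁻¹' {c}) b) : IsLeast (f ⁻¹' {b}) a := by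
  obtain ⟨m, hm⟩ := exists_isLeast hf.surjective b
  obtain ⟨n, hn⟩ := exists_isLeast hf.surjective (f a)
  have hfm : f m = b := hm.1
  have ham : a ≤ m := ha.2 (by
    change g (f m) = c
    rw [hfm]
    exact hb.1)
  have hba : b ≤ f a := hb.2 ha.1
  have hna : n ≤ a := hn.2 rfl
  rcases hba.lt_or_eq with h | h
  · exact absurd (hf.min_lt_min b (f a) m n h hm hn) (not_lt.mpr (hna.trans ham))
  · refine ⟨h.symm, fun x hx => ham.trans (hm.2 hx)⟩

theorem comp {A B C : Type u} [Finite A] [Finite B] [Finite C]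
    {ordA : LinearOrder A} {ordB : LinearOrder B} {ordC : LinearOrder C}
    {f : A → B} {g : B → C} (hg : IsRigidSurjection ordB ordC g)
    (hf : IsRigidSurjection ordA ordB f) :
    IsRigidSurjection ordA ordC (fun x => g (f x)) where
  surjective := hg.surjective.comp hf.surjective
  min_lt_min := by
    intro c c' a a' h ha ha'
    obtain ⟨b, hb⟩ := exists_isLeast hg.surjective c
    obtain ⟨b', hb'⟩ := exists_isLeast hg.surjective c'
    exact hf.min_lt_min b b' a a' (hg.min_lt_min c c' b b' h hb hb')
      (isLeast_of_comp hf ha hb) (isLeast_of_comp hf ha' hb')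

end IsRigidSurjection

/-- A finite permutation `(A, <, ⊏)`: a finite set with two linear orders. These are the objects
of the category `Perm_quo`. -/
structure PermQuo : Type (u + 1) where
  carrier : Type u
  finite : Finite carrier
  ord₁ : LinearOrder carrier
  ord₂ : LinearOrder carrier

namespace PermQuo

instance (A : PermQuo.{u}) : Finite A.carrier := A.finite

/-- Quotient maps for permutations: rigid surjections with respect to both orders. -/
@[ext]
structure Hom (A B : PermQuo.{u}) : Type u where
  toFun : A.carrier → B.carrier
  rigid₁ : IsRigidSurjection A.ord₁ B.ord₁ toFun
  rigid₂ : IsRigidSurjection A.ord₂ B.ord₂ toFun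

instance : Category.{u} PermQuo.{u} where
  Hom := Hom
  id A := ⟨fun x => x, IsRigidSurjection.id A.ord₁, IsRigidSurjection.id A.ord₂⟩
  comp f g := ⟨fun x => g.toFun (f.toFun x), g.rigid₁.comp f.rigid₁, g.rigid₂.comp f.rigid₂⟩

end PermQuo

/-! A disjoint sum of chains decouples the two orders of a permutation. Let `C₁` precede `C₂` in the
first order and follow it in the second. A map on the sum is rigid for both orders once its
restriction to `C₁` is rigid for the first and its restriction to `C₂` for the second: in either
order the other summand comes after every value has been attained. A quotient map `f` composes with
both restrictions, so a product dual Ramsey theorem for pairs of rigid surjections, applied on the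
diagonal `f₁ = f₂ = f`, suffices. It follows from the one-chain theorem by using functions as
colors.

The one-chain theorem, `wordRamsey`, goes by induction on the size of the target. A rigid word onto
`a + 1` letters is `x ++ a :: z` with `x` rigid onto `a` letters. By Hales–Jewett,
`exists_color_eq_of_prefix_eq` makes the color depend on `x` alone. The case `a`, used for prefixes
of each length, and a pigeonhole over lengths (`WordRamsey.exists_monochromatic_levels`) then remove
the dependence on `x`. -/

/-- `RigidWord w b`: the letters of the word `w` are exactly the numbers below `b`, and they first
occur in increasing order. Such words encode the rigid surjections from a chain with `w.length`
elements onto a chain with `b` elements. -/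
inductive RigidWord : List ℕ → ℕ → Prop
  | nil : RigidWord [] 0
  | new {w : List ℕ} {b : ℕ} : RigidWord w b → RigidWord (w ++ [b]) (b + 1)
  | old {w : List ℕ} {b c : ℕ} : RigidWord w b → c < b → RigidWord (w ++ [c]) b

/-- The word obtained from `w` by replacing each letter `i` by the `i`-th letter of `g`; it encodes
the composite of the maps encoded by `w` and `g`. -/
def wordSubst (g w : List ℕ) : List ℕ := w.map fun i => g.getD i 0

/-- The part of `w` that precedes the first letter not below `j`. -/
def wordLevel (j : ℕ) (w : List ℕ) : List ℕ := w.takeWhile fun i => decide (i < j)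

/-! ### Substitution of words as composition of maps -/

section wordSubst

@[simp]
theorem length_wordSubst (g w : List ℕ) : (wordSubst g w).length = w.length := by
  simp [wordSubst]

@[simp]
theorem wordSubst_append (g w w' : List ℕ) :
    wordSubst g (w ++ w') = wordSubst g w ++ wordSubst g w' := by
  simp [wordSubst]

@[simp]
theorem wordSubst_cons (g : List ℕ) (i : ℕ) (w : List ℕ) :
    wordSubst g (i :: w) = g.getD i 0 :: wordSubst g w := by
  simp [wordSubst]

@[simp]
theorem wordSubst_nil (g : List ℕ) : wordSubst g [] = [] := rfl

theorem wordSubst_append_left {g w : List ℕ} (h : ∀ i ∈ w, i < g.length) (g' : List ℕ) :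
    wordSubst (g ++ g') w = wordSubst g w :=
  List.map_congr_left fun i hi => List.getD_append _ _ _ _ (h i hi)

theorem wordSubst_assoc {f g w : List ℕ} (h : ∀ i ∈ w, i < g.length) :
    wordSubst f (wordSubst g w) = wordSubst (wordSubst f g) w := by
  unfold wordSubst
  rw [List.map_map]
  refine List.map_congr_left fun i hi => ?_
  simp [List.getD_eq_getElem?_getD, List.getElem?_eq_getElem (h i hi)]

theorem wordSubst_range (g : List ℕ) : wordSubst g (List.range g.length) = g := by
  apply List.ext_getElem <;> simp +contextual [wordSubst]

theorem wordSubst_range_append {g : List ℕ} {n : ℕ} (h : g.length = n) (g' : List ℕ) :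
    wordSubst (g ++ g') (List.range n) = g := by
  subst h
  rw [wordSubst_append_left (by simp), wordSubst_range]

theorem mem_wordSubst_of_forall {g w : List ℕ} {P : ℕ → Prop} (hg : ∀ c ∈ g, P c)
    (hw : ∀ i ∈ w, i < g.length) : ∀ c ∈ wordSubst g w, P c := by
  intro c hc
  obtain ⟨i, hi, rfl⟩ := List.mem_map.1 hc
  rw [List.getD_eq_getElem _ _ (hw i hi)]
  exact hg _ (List.getElem_mem _)

theorem exists_wordSubst_eq {g z : List ℕ} (h : ∀ c ∈ z, c ∈ g) :
    ∃ y : List ℕ, (∀ i ∈ y, i < g.length) ∧ wordSubst g y = z := by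
  induction z with
  | nil => exact ⟨[], by simp, rfl⟩
  | cons c z ih =>
    obtain ⟨y, hy, rfl⟩ := ih fun d hd => h d (List.mem_cons_of_mem _ hd)
    obtain ⟨i, hi, hc⟩ := List.getElem_of_mem (h c List.mem_cons_self)
    refine ⟨i :: y, ?_, by simp [hi, hc]⟩
    simpa [hi] using hy

end wordSubst

/-! ### Rigid words and their levels -/

namespace RigidWord

theorem mem_iff {w : List ℕ} {b : ℕ} (h : RigidWord w b) (c : ℕ) : c ∈ w ↔ c < b := by
  induction h with
  | nil => simp
  | new _ ih => simp only [List.mem_append, ih, List.mem_singleton]; omega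
  | old _ hc ih => simp only [List.mem_append, ih, List.mem_singleton]; omega

theorem lt_of_mem {w : List ℕ} {b : ℕ} (h : RigidWord w b) : ∀ c ∈ w, c < b :=
  fun c => (h.mem_iff c).1

theorem le_length {w : List ℕ} {b : ℕ} (h : RigidWord w b) : b ≤ w.length := by
  induction h with
  | nil => simp
  | new _ ih => simpa using ih
  | old _ hc ih => simp only [List.length_append]; omega

theorem range (n : ℕ) : RigidWord (List.range n) n := by
  induction n with
  | zero => exact nil
  | succ n ih => rw [List.range_succ]; exact ih.new

theorem append_of_lt {w : List ℕ} {b : ℕ} (h : RigidWord w b) {v : List ℕ}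
    (hv : ∀ c ∈ v, c < b) : RigidWord (w ++ v) b := by
  induction v using List.reverseRecOn with
  | nil => simpa using h
  | append_singleton v c ih =>
    rw [← List.append_assoc]
    exact (ih fun d hd => hv d (by simp [hd])).old (hv c (by simp))

theorem append_range {w : List ℕ} {b : ℕ} (h : RigidWord w b) (n : ℕ) :
    RigidWord (w ++ (List.range n).map (b + ·)) (b + n) := by
  induction n with
  | zero => simpa using h
  | succ n ih =>
    rw [List.range_succ, List.map_append, ← List.append_assoc]
    exact ih.new

theorem exists_eq_append_cons {w : List ℕ} {b : ℕ} (h : RigidWord w b) {j : ℕ} (hj : j < b) :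
    ∃ p z, w = p ++ j :: z ∧ RigidWord p j := by
  induction h with
  | nil => omega
  | @new w b hw ih =>
    rcases Nat.lt_succ_iff_lt_or_eq.1 hj with hj | rfl
    · obtain ⟨p, z, rfl, hp⟩ := ih hj
      exact ⟨p, z ++ [b], by simp, hp⟩
    · exact ⟨w, [], rfl, hw⟩
  | @old w b c hw hc ih =>
    obtain ⟨p, z, rfl, hp⟩ := ih hj
    exact ⟨p, z ++ [c], by simp, hp⟩

theorem wordSubst {w : List ℕ} {b : ℕ} (h : RigidWord w b) {g : List ℕ} {a : ℕ}
    (hg : RigidWord g a) (hb : g.length = b) : RigidWord (wordSubst g w) a := by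
  induction h generalizing g a with
  | nil =>
    obtain rfl := List.length_eq_zero_iff.1 hb
    exact hg
  | @new w b hw ih =>
    -- The last letter `b` of the outer word is replaced by the last letter of `g`, which is new in
    -- the composite exactly when it is new in `g`.
    cases hg with
    | nil => simp at hb
    | @new g a hg =>
      simp only [List.length_append, List.length_singleton, Nat.add_right_cancel_iff] at hb
      rw [wordSubst_append, wordSubst_append_left fun i hi => hb ▸ hw.lt_of_mem i hi]
      simpa [hb] using (ih hg hb).new
    | @old g _ c hg hc =>
      simp only [List.length_append, List.length_singleton, Nat.add_right_cancel_iff] at hb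
      rw [wordSubst_append, wordSubst_append_left fun i hi => hb ▸ hw.lt_of_mem i hi]
      simpa [hb] using (ih hg hb).old hc
  | @old w b c hw hc ih =>
    rw [wordSubst_append]
    refine (ih hg hb).old ?_
    subst hb
    change g.getD c 0 < a
    rw [List.getD_eq_getElem _ _ hc]
    exact hg.lt_of_mem _ (List.getElem_mem _)

theorem exists_of_forall_append {w : List ℕ}
    (h : ∀ p c z, w = p ++ c :: z → ∀ d < c, d ∈ p) : ∃ b, RigidWord w b := by
  induction w using List.reverseRecOn with
  | nil => exact ⟨0, nil⟩
  | append_singleton w c ih =>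
    obtain ⟨b, hb⟩ := ih fun p d z hp => h p d (z ++ [c]) (by simp [hp])
    have hc := h w c [] rfl
    rcases lt_trichotomy c b with hcb | rfl | hcb
    · exact ⟨b, hb.old hcb⟩
    · exact ⟨_, hb.new⟩
    · exact absurd ((hb.mem_iff b).1 (hc b hcb)) (lt_irrefl b)

end RigidWord

theorem wordLevel_append_cons {p : List ℕ} {j : ℕ} (h : ∀ i ∈ p, i < j) (z : List ℕ) :
    wordLevel j (p ++ j :: z) = p := by
  unfold wordLevel
  rw [List.takeWhile_append_of_pos (by simpa using h)]
  simp

namespace RigidWord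

theorem exists_eq_wordLevel_append {w : List ℕ} {b : ℕ} (h : RigidWord w b) {j : ℕ} (hj : j < b) :
    ∃ z, w = wordLevel j w ++ j :: z ∧ RigidWord (wordLevel j w) j := by
  obtain ⟨p, z, rfl, hp⟩ := h.exists_eq_append_cons hj
  rw [wordLevel_append_cons hp.lt_of_mem]
  exact ⟨z, rfl, hp⟩

theorem length_wordLevel_lt {w : List ℕ} {b : ℕ} (h : RigidWord w b) {j : ℕ} (hj : j < b) :
    (wordLevel j w).length < w.length := by
  obtain ⟨z, hz, -⟩ := h.exists_eq_wordLevel_append hj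
  conv_rhs => rw [hz]
  simp

theorem wordLevel_append {w : List ℕ} {b : ℕ} (h : RigidWord w b) {j : ℕ} (hj : j < b)
    (z : List ℕ) : wordLevel j (w ++ z) = wordLevel j w := by
  obtain ⟨p, y, rfl, hp⟩ := h.exists_eq_append_cons hj
  rw [wordLevel_append_cons hp.lt_of_mem, List.append_assoc, List.cons_append,
    wordLevel_append_cons hp.lt_of_mem]

/-- The part of a composite word before the first occurrence of `j` is again a composite. -/
theorem wordLevel_wordSubst {u v : List ℕ} {b : ℕ} (hu : RigidWord u v.length)
    (hv : RigidWord v b) {j : ℕ} (hj : j < b) :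
    wordLevel j (_root_.wordSubst v u) =
      _root_.wordSubst (wordLevel j v) (wordLevel (wordLevel j v).length u) := by
  have hlt := hv.length_wordLevel_lt hj
  obtain ⟨y, hy, hvj⟩ := hv.exists_eq_wordLevel_append hj
  generalize wordLevel j v = p at *
  obtain ⟨z, hz, huj⟩ := hu.exists_eq_wordLevel_append hlt
  generalize wordLevel p.length u = q at *
  have hq : _root_.wordSubst v q = _root_.wordSubst p q := by
    rw [hy, wordSubst_append_left huj.lt_of_mem]
  rw [hz, wordSubst_append, wordSubst_cons, hq]
  have : v.getD p.length 0 = j := by rw [hy]; simp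
  rw [this]
  exact wordLevel_append_cons (huj.wordSubst hvj rfl).lt_of_mem _

end RigidWord

/-! ### Hales–Jewett and colorings that depend only on a prefix -/

/-- A form of the Hales–Jewett theorem for words over the alphabet of the numbers below `q`, with
`m` parameters (the letters `q, …, q + m - 1`) that first occur in increasing order. -/
theorem exists_monochromatic_parameter_word (κ : Type v) [Finite κ] (q m : ℕ) :
    ∃ N : ℕ, ∀ χ : List ℕ → κ, ∃ h : List ℕ, h.length = N ∧
      RigidWord (List.range q ++ h) (q + m) ∧
      ∃ c, ∀ z : List ℕ, z.length = m → (∀ i ∈ z, i < q) →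
        χ (wordSubst (List.range q ++ z) h) = c := by
  obtain ⟨ι, _, hι⟩ := Combinatorics.Line.exists_mono_in_high_dimension (Fin m → Fin q) κ
  set e : List ι := Finset.univ.toList
  let word : (Fin m → Fin q) → List ℕ := fun y => List.ofFn fun k => (y k : ℕ)
  have hword : ∀ y, ∀ i ∈ word y, i < q := by
    intro y i hi
    obtain ⟨k, rfl⟩ := (List.mem_ofFn' _ _).1 hi
    exact (y k).2
  let block : Option (Fin m → Fin q) → List ℕ :=
    fun o => o.elim ((List.range m).map (q + ·)) word
  have hblock_length : ∀ o, (block o).length = m := by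
    rintro (_ | y) <;> simp [block, word]
  have hblock_lt : ∀ o, ∀ i ∈ block o, i < q + m := by
    rintro (_ | y) i hi
    · simp only [block, Option.elim, List.mem_map, List.mem_range] at hi
      omega
    · exact (hword y i hi).trans_le (Nat.le_add_right _ _)
  refine ⟨(e.map fun _ => m).sum, fun χ => ?_⟩
  obtain ⟨l, c, hl⟩ := hι fun f => χ (e.flatMap fun i => word (f i))
  refine ⟨e.flatMap fun i => block (l.idxFun i), ?_, ?_, c, ?_⟩
  · simp [List.length_flatMap, hblock_length]
  · have key : ∀ (e : List ι) (w : List ℕ), RigidWord w q → (∃ i ∈ e, l.idxFun i = none) →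
        RigidWord (w ++ e.flatMap fun i => block (l.idxFun i)) (q + m) := by
      intro e
      induction e with
      | nil => simp
      | cons i e ih =>
        intro w hw hex
        rw [List.flatMap_cons, ← List.append_assoc]
        cases hi : l.idxFun i with
        | none =>
          -- The first variable block introduces all `m` parameters in order, so the letters after
          -- it are unconstrained.
          refine (hw.append_range m).append_of_lt fun c hc => ?_
          obtain ⟨j, -, hj⟩ := List.mem_flatMap.1 hc
          exact hblock_lt _ _ hj
        | some y =>
          refine ih _ (hw.append_of_lt (hword y)) ?_
          obtain ⟨j, hj, hj'⟩ := hex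
          rcases List.mem_cons.1 hj with rfl | hj
          · simp [hi] at hj'
          · exact ⟨j, hj, hj'⟩
    obtain ⟨i, hi⟩ := l.proper
    exact key e _ (RigidWord.range q) ⟨i, by simp [e], hi⟩
  · intro z hz hzq
    let y : Fin m → Fin q := fun k => ⟨z[k], hzq _ (List.getElem_mem _)⟩
    have hy : word y = z := by
      subst hz
      exact List.ofFn_getElem
    rw [← hl y]
    change _ = χ (e.flatMap fun i => word (l y i))
    congr 1
    unfold wordSubst
    rw [List.map_flatMap]
    congr 1
    funext i
    rw [Combinatorics.Line.apply_def]
    beta_reduce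
    generalize l.idxFun i = o
    cases o with
    | none =>
      simp only [block, Option.elim, Option.getD, hy, List.map_map]
      apply List.ext_getElem
      · simp [hz]
      · intro k hk hk'
        simp [hk']
    | some x =>
      change (word x).map _ = word x
      conv_rhs => rw [← List.map_id (word x)]
      refine List.map_congr_left fun k hk => ?_
      simp [List.getElem?_append_left, hword x k hk]

/-- Each coloring becomes, after composition with a suitable rigid word, independent of the
letters that follow the first occurrence of the letter `a`. -/
theorem exists_color_eq_of_prefix_eq (κ : Type v) [Finite κ] (a t : ℕ) : ∀ i : ℕ,
    ∃ n : ℕ, ∀ χ : List ℕ → κ, ∃ w : List ℕ, w.length = n ∧ RigidWord w (i + t) ∧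
      (∃ w', w = List.range i ++ w') ∧
      ∀ x z z' : List ℕ, i ≤ x.length → RigidWord x a → (∀ c ∈ z, c ≤ a) → (∀ c ∈ z', c ≤ a) →
        (x ++ a :: z).length = i + t → (x ++ a :: z').length = i + t →
        χ (wordSubst (x ++ a :: z) w) = χ (wordSubst (x ++ a :: z') w) := by
  induction t with
  | zero =>
    intro i
    refine ⟨i, fun χ => ⟨List.range i, by simp, RigidWord.range i, ⟨[], by simp⟩, ?_⟩⟩
    intro x z z' hx _ _ _ h
    simp only [List.length_append, List.length_cons] at h
    omega
  | succ t ih =>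
    intro i
    obtain ⟨n, hn⟩ := ih (i + 1)
    -- The constants `0, …, i` stand for the positions of `x ++ [a]`. Taking functions of `x` as
    -- colors lets one parameter word serve all `x` of length `i` at once.
    obtain ⟨N, hN⟩ :=
      exists_monochromatic_parameter_word ((Fin i → Fin a) → κ) (i + 1) (n - (i + 1))
    refine ⟨i + 1 + N, fun χ => ?_⟩
    obtain ⟨h, hhN, hh, c, hc⟩ := hN fun u x =>
      χ (List.ofFn (fun k => (x k : ℕ)) ++
        a :: wordSubst (List.ofFn (fun k => (x k : ℕ)) ++ [a]) u)
    set v := List.range (i + 1) ++ h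
    obtain ⟨w, hwn, hw, ⟨w', hw'⟩, hwχ⟩ := hn fun y => χ (wordSubst y v)
    have hin : i + 1 ≤ n := by rw [← hwn, hw']; simp
    rw [Nat.add_sub_cancel' hin] at hh
    have hvlt : ∀ j ∈ v, j < w.length := hwn ▸ hh.lt_of_mem
    refine ⟨wordSubst w v, by simp [v, hhN], ?_, ?_, ?_⟩
    · rw [← Nat.add_right_comm, Nat.add_assoc i t 1] at hw
      exact hh.wordSubst hw hwn
    · have : wordSubst w v = List.range (i + 1) ++ wordSubst w h := by
        rw [wordSubst_append]
        congr 1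
        rw [hw', wordSubst_range_append (by simp)]
      rw [this, List.range_succ, List.append_assoc]
      exact ⟨_, rfl⟩
    · intro x z z' hix hx hz hz' hl hl'
      rw [wordSubst_assoc hvlt, wordSubst_assoc hvlt]
      rcases hix.lt_or_eq with hix | hix
      · exact hwχ x z z' hix hx hz hz' (by omega) (by omega)
      -- When `x` has length exactly `i`, every letter up to `a` already occurs in `x ++ [a]`. The
      -- rest of the word therefore factors through `x ++ [a]` and becomes an instance of the
      -- parameter word.
      · have key : ∀ z : List ℕ, (∀ c ∈ z, c ≤ a) → (x ++ a :: z).length = i + (t + 1) →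
            χ (wordSubst (wordSubst (x ++ a :: z) w) v) =
              c fun k => ⟨x[k], hx.lt_of_mem _ (List.getElem_mem _)⟩ := by
          intro z hz hl
          have hxa : (x ++ [a]).length = i + 1 := by simp [hix]
          have hxr : List.ofFn (fun k : Fin i => x[k]) = x := by
            subst hix
            exact List.ofFn_getElem
          have h1 : wordSubst (x ++ a :: z) w = (x ++ [a]) ++ wordSubst (x ++ a :: z) w' := by
            rw [hw', wordSubst_append, List.append_cons, wordSubst_range_append hxa]
          have hmem : ∀ c ∈ wordSubst (x ++ a :: z) w', c ∈ x ++ [a] := by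
            refine mem_wordSubst_of_forall ?_ fun j hj => ?_
            · intro c hc
              have : c ≤ a := by
                simp only [List.mem_append, List.mem_cons] at hc
                rcases hc with hc | rfl | hc
                · exact (hx.lt_of_mem c hc).le
                · exact le_rfl
                · exact hz c hc
              rcases this.lt_or_eq with hc | rfl
              · exact List.mem_append_left _ ((hx.mem_iff c).2 hc)
              · simp
            · rw [hl]
              have := hw.lt_of_mem j (by rw [hw']; exact List.mem_append_right _ hj)
              omega
          obtain ⟨y, hy, hyz⟩ := exists_wordSubst_eq hmem
          have hyl : y.length = n - (i + 1) := by
            have h2 := congrArg List.length hyz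
            have h3 := congrArg List.length hw'
            simp only [length_wordSubst, List.length_append, List.length_range] at h2 h3
            omega
          have hr : wordSubst (x ++ [a]) (List.range (i + 1) ++ y) = wordSubst (x ++ a :: z) w := by
            rw [wordSubst_append, hyz, ← hxa, wordSubst_range, h1]
          have h4 := congrFun (hc y hyl (hxa ▸ hy)) fun k =>
            ⟨x[k], hx.lt_of_mem _ (List.getElem_mem _)⟩
          simp only [hxr] at h4
          rw [← h4, wordSubst_assoc, hr, wordSubst_append, h1, wordSubst_range_append hxa]
          · simp
          · intro j hj
            have := hh.lt_of_mem j (List.mem_append_right _ hj)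
            simp only [List.length_append, List.length_range, hyl]
            omega
        rw [key z hz hl, key z' hz' hl']

/-! ### Dual Ramsey theorem for words -/

/-- The Ramsey property of rigid words with target `a`: every coloring is constant on the
composites of a suitable rigid word of length `n` with all rigid words of length `b`. -/
def WordRamsey (κ : Type v) (a : ℕ) : Prop :=
  ∀ b : ℕ, ∃ n : ℕ, ∀ χ : List ℕ → κ, ∃ w : List ℕ, w.length = n ∧ RigidWord w b ∧
    ∃ c, ∀ g : List ℕ, g.length = b → RigidWord g a → χ (wordSubst g w) = c

/-- If `g = x ++ a :: z` with `x` of length `j`, then `x` composed with level `j` of `w` is what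
precedes the first `a` in the composite of `g` and `w`. Levels are treated from the top down: `u`
settles the longest one, and the induction hypothesis refines `u` for the shorter ones. -/
theorem WordRamsey.exists_color_levels {κ : Type v} {a : ℕ} (h : WordRamsey κ a) (b : ℕ) :
    ∃ n : ℕ, ∀ χ : List ℕ → κ, ∃ w : List ℕ, w.length = n ∧ RigidWord w b ∧
      ∃ c : ℕ → κ, ∀ j < b, ∀ x : List ℕ, x.length = j → RigidWord x a →
        χ (wordSubst x (wordLevel j w)) = c j := by
  induction b with
  | zero => exact ⟨0, fun χ => ⟨[], rfl, RigidWord.nil, fun _ => χ [], by simp⟩⟩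
  | succ b ih =>
    obtain ⟨m, hm⟩ := ih
    obtain ⟨n, hn⟩ := h m
    refine ⟨n + 1, fun χ => ?_⟩
    obtain ⟨u, hun, hu, d, hd⟩ := hn χ
    obtain ⟨v, rfl, hv, c, hc⟩ := hm fun x => χ (wordSubst x (wordLevel x.length u))
    have hvu := hu.wordSubst hv rfl
    refine ⟨wordSubst v u ++ [b], by simp [hun], hvu.new, fun j => if j < b then c j else d, ?_⟩
    intro j hj x hxj hx
    beta_reduce
    rcases Nat.lt_succ_iff_lt_or_eq.1 hj with hj | rfl
    · have hlt := hv.length_wordLevel_lt hj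
      obtain ⟨-, -, huj⟩ := hu.exists_eq_wordLevel_append hlt
      obtain ⟨-, -, hvj⟩ := hv.exists_eq_wordLevel_append hj
      rw [if_pos hj, ← hc j hj x hxj hx, hvu.wordLevel_append hj, hu.wordLevel_wordSubst hv hj,
        wordSubst_assoc huj.lt_of_mem, length_wordSubst]
    · rw [if_neg (lt_irrefl _), wordLevel_append_cons hvu.lt_of_mem,
        wordSubst_assoc hu.lt_of_mem]
      exact hd _ (length_wordSubst _ _) (hv.wordSubst hx hxj)

theorem exists_rigidWord_levels_mem {a : ℕ} (ha : 0 < a) (J : Finset ℕ) (n : ℕ) :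
    ∃ w : List ℕ, w.length = a + n ∧ RigidWord w (a + ((Finset.range n).filter (· ∈ J)).card) ∧
      ∀ j, a ≤ j → j < a + ((Finset.range n).filter (· ∈ J)).card →
        ∃ i ∈ J, (wordLevel j w).length = a + i := by
  induction n with
  | zero =>
    refine ⟨List.range a, by simp, by simpa using RigidWord.range a, fun j h h' => ?_⟩
    simp only [Finset.range_zero, Finset.filter_empty, Finset.card_empty] at h'
    omega
  | succ n ih =>
    obtain ⟨w, hwn, hw, hj⟩ := ih
    rw [Finset.range_add_one, Finset.filter_insert]
    split_ifs with hn
    · rw [Finset.card_insert_of_notMem (by simp)]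
      refine ⟨_, ?_, hw.new, fun j h h' => ?_⟩
      · simp [hwn, Nat.add_assoc]
      · rcases Nat.lt_succ_iff_lt_or_eq.1 h' with h' | h'
        · rw [hw.wordLevel_append h']
          exact hj j h h'
        · change j = a + _ at h'
          subst h'
          rw [wordLevel_append_cons hw.lt_of_mem, hwn]
          exact ⟨n, hn, rfl⟩
    -- At a position outside `J` the old letter `0` is filler; it is available because `0 < a`.
    · refine ⟨_, ?_, hw.old (c := 0) (by omega), fun j h h' => ?_⟩
      · simp [hwn, Nat.add_assoc]
      · rw [hw.wordLevel_append h']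
        exact hj j h h'

theorem exists_rigidWord_monochromatic_levels (κ : Type v) [Finite κ] {a b : ℕ} (ha : 0 < a)
    (hab : a ≤ b) : ∃ n : ℕ, ∀ c : ℕ → κ, ∃ w : List ℕ, w.length = n ∧ RigidWord w b ∧
      ∃ d, ∀ j, a ≤ j → j < b → c (wordLevel j w).length = d := by
  classical
  cases nonempty_fintype κ
  -- Pigeonhole: some color occurs at `b - a` or more of these positions, and the letters `a, …, b -
  -- 1` are made to appear first there.
  refine ⟨a + (Fintype.card κ * (b - a) + 1), fun c => ?_⟩
  obtain ⟨d, -, hd⟩ := Finset.exists_lt_card_fiber_of_mul_lt_card_of_maps_to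
    (s := Finset.range (Fintype.card κ * (b - a) + 1)) (t := Finset.univ)
    (f := fun i => c (a + i)) (n := b - a) (by simp) (by simp)
  obtain ⟨J, hJ, hJc⟩ := Finset.exists_subset_card_eq hd.le
  obtain ⟨w, hwn, hw, hwJ⟩ :=
    exists_rigidWord_levels_mem ha J (Fintype.card κ * (b - a) + 1)
  have hcard : a + ((Finset.range (Fintype.card κ * (b - a) + 1)).filter (· ∈ J)).card = b := by
    rw [Finset.filter_mem_eq_inter,
      Finset.inter_eq_right.2 fun i hi => (Finset.mem_filter.1 (hJ hi)).1, hJc]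
    omega
  rw [hcard] at hw hwJ
  refine ⟨w, hwn, hw, d, fun j h h' => ?_⟩
  obtain ⟨i, hi, hij⟩ := hwJ j h h'
  rw [hij]
  exact (Finset.mem_filter.1 (hJ hi)).2

theorem WordRamsey.exists_monochromatic_levels {κ : Type v} [Finite κ] {a : ℕ}
    (h : WordRamsey κ a) (ha : 0 < a) {b : ℕ} (hab : a ≤ b) :
    ∃ n : ℕ, ∀ χ : List ℕ → κ, ∃ w : List ℕ, w.length = n ∧ RigidWord w b ∧
      ∃ c, ∀ j < b, ∀ x : List ℕ, x.length = j → RigidWord x a →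
        χ (wordSubst x (wordLevel j w)) = c := by
  obtain ⟨m, hm⟩ := exists_rigidWord_monochromatic_levels κ ha hab
  obtain ⟨n, hn⟩ := h.exists_color_levels m
  refine ⟨n, fun χ => ?_⟩
  obtain ⟨w, hwn, hw, c, hc⟩ := hn χ
  obtain ⟨v, rfl, hv, d, hd⟩ := hm c
  refine ⟨wordSubst v w, by simp [hwn], hw.wordSubst hv rfl, d, fun j hj x hxj hx => ?_⟩
  have hlt := hv.length_wordLevel_lt hj
  obtain ⟨-, -, hwj⟩ := hw.exists_eq_wordLevel_append hlt
  obtain ⟨-, -, hvj⟩ := hv.exists_eq_wordLevel_append hj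
  rw [hw.wordLevel_wordSubst hv hj, wordSubst_assoc hwj.lt_of_mem,
    hc _ hlt _ (length_wordSubst _ _) (hvj.wordSubst hx hxj)]
  exact hd j (hxj ▸ hx.le_length) hj

theorem exists_wordRamsey_of_lt (κ : Type v) {a b : ℕ} (hab : b < a) :
    ∃ n : ℕ, ∀ χ : List ℕ → κ, ∃ w : List ℕ, w.length = n ∧ RigidWord w b ∧
      ∃ c, ∀ g : List ℕ, g.length = b → RigidWord g a → χ (wordSubst g w) = c := by
  refine ⟨b, fun χ => ⟨List.range b, by simp, RigidWord.range b, χ [], fun g hg hga => ?_⟩⟩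
  have := hga.le_length
  omega

theorem WordRamsey.of_le_one (κ : Type v) {a : ℕ} (ha : a ≤ 1) : WordRamsey κ a := by
  refine fun b => ⟨b, fun χ => ⟨List.range b, by simp, RigidWord.range b,
    χ (wordSubst (List.replicate b 0) (List.range b)), fun g hg hga => ?_⟩⟩
  have : g = List.replicate b 0 :=
    List.eq_replicate_iff.2 ⟨hg, fun i hi => Nat.lt_one_iff.1 ((hga.lt_of_mem i hi).trans_le ha)⟩
  rw [this]

theorem WordRamsey.succ {κ : Type v} [Finite κ] {a : ℕ} (h : WordRamsey κ a) (ha : 0 < a) :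
    WordRamsey κ (a + 1) := by
  intro b
  rcases Nat.lt_or_ge b (a + 1) with hab | hab
  · exact exists_wordRamsey_of_lt κ hab
  obtain ⟨m, hm⟩ := h.exists_monochromatic_levels ha (Nat.le_of_succ_le hab)
  obtain ⟨n, hn⟩ := exists_color_eq_of_prefix_eq κ a m 0
  refine ⟨n, fun χ => ?_⟩
  obtain ⟨w, hwn, hw, -, hwχ⟩ := hn χ
  -- Since the color ignores what follows `a`, padding with zeros up to length `m` turns it into a
  -- coloring of prefixes.
  obtain ⟨v, rfl, hv, c, hc⟩ :=
    hm fun x => χ (wordSubst (x ++ a :: List.replicate (m - (x.length + 1)) 0) w)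
  rw [Nat.zero_add] at hw
  refine ⟨wordSubst v w, by simp [hwn], hw.wordSubst hv rfl, c, fun g hg hga => ?_⟩
  obtain ⟨x, z, rfl, hx⟩ := hga.exists_eq_append_cons a.lt_succ_self
  have hxb : x.length < b := by
    rw [← hg]
    simp
  obtain ⟨y, hy, hvj⟩ := hv.exists_eq_wordLevel_append hxb
  have hle : ∀ c ∈ wordSubst (x ++ a :: z) y, c ≤ a := by
    refine mem_wordSubst_of_forall (fun c hc => Nat.le_of_lt_succ (hga.lt_of_mem c hc)) ?_
    intro i hi
    rw [hg]
    exact hv.lt_of_mem i (by rw [hy]; simp [hi])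
  have hsubst : wordSubst (x ++ a :: z) v =
      wordSubst x (wordLevel x.length v) ++ a :: wordSubst (x ++ a :: z) y := by
    conv_lhs => rw [hy]
    rw [wordSubst_append, wordSubst_cons, wordSubst_append_left hvj.lt_of_mem]
    simp
  have hlen := congrArg List.length hsubst
  rw [length_wordSubst] at hlen
  rw [← hc x.length hxb x rfl hx, wordSubst_assoc hw.lt_of_mem, hsubst]
  refine hwχ _ _ _ (Nat.zero_le _) (hvj.wordSubst hx rfl) hle ?_ (by simpa using hlen.symm) ?_
  · intro i hi
    simp [List.eq_of_mem_replicate hi]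
  · simp only [List.length_append, List.length_cons, length_wordSubst,
      List.length_replicate] at hlen ⊢
    omega

/-- The dual Ramsey theorem of Graham and Rothschild, for words. -/
theorem wordRamsey (κ : Type v) [Finite κ] (a : ℕ) : WordRamsey κ a := by
  induction a with
  | zero => exact WordRamsey.of_le_one κ (Nat.zero_le 1)
  | succ a ih =>
    rcases Nat.eq_zero_or_pos a with rfl | ha
    · exact WordRamsey.of_le_one κ le_rfl
    · exact ih.succ ha

/-! ### Translation between rigid words and rigid surjections -/

theorem isRigidSurjection_iff {A B : Type u} [Finite A] [Finite B] [ordA : LinearOrder A]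
    [ordB : LinearOrder B] {f : A → B} :
    IsRigidSurjection ordA ordB f ↔
      Function.Surjective f ∧ ∀ a, ∀ b < f a, ∃ a' < a, f a' = b := by
  constructor
  · refine fun hf => ⟨hf.surjective, fun a b hb => ?_⟩
    obtain ⟨m, hm⟩ := IsRigidSurjection.exists_isLeast hf.surjective b
    obtain ⟨m', hm'⟩ := IsRigidSurjection.exists_isLeast hf.surjective (f a)
    exact ⟨m, (hf.min_lt_min b (f a) m m' hb hm hm').trans_le (hm'.2 rfl), hm.1⟩
  · refine fun ⟨hs, hf⟩ => ⟨hs, fun b b' a a' hb ha ha' => ?_⟩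
    obtain ⟨x, hx, hxb⟩ := hf a' b (by rwa [show f a' = b' from ha'.1])
    exact (ha.2 hxb).trans_lt hx

theorem RigidWord.exists_lt_getElem_eq {w : List ℕ} {b : ℕ} (h : RigidWord w b) {i d : ℕ}
    (hi : i < w.length) (hd : d < w[i]) : ∃ i', ∃ h' : i' < i, w[i'] = d := by
  obtain ⟨p, z, rfl, hp⟩ :=
    h.exists_eq_append_cons (hd.trans (h.lt_of_mem _ (List.getElem_mem hi)))
  refine ⟨p.length, ?_, by simp⟩
  by_contra! hip
  rcases hip.lt_or_eq with hip | rfl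
  · rw [List.getElem_append_left hip] at hd
    exact lt_asymm hd (hp.lt_of_mem _ (List.getElem_mem hip))
  · simp at hd

section chainWord

variable {A B C : Type u} [LinearOrder A] [LinearOrder B] [LinearOrder C] {l m n : ℕ}

/-- The word encoding a map between finite chains. -/
def chainWord (eA : Fin n ≃o A) (eB : Fin m ≃o B) (f : A → B) : List ℕ :=
  List.ofFn fun i => (eB.symm (f (eA i)) : ℕ)

@[simp]
theorem length_chainWord (eA : Fin n ≃o A) (eB : Fin m ≃o B) (f : A → B) :
    (chainWord eA eB f).length = n := by
  simp [chainWord]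

theorem chainWord_injective (eA : Fin n ≃o A) (eB : Fin m ≃o B) :
    Function.Injective (chainWord eA eB) := by
  intro f g h
  funext x
  have := congrFun (List.ofFn_injective h) (eA.symm x)
  simpa [Fin.val_inj] using this

theorem chainWord_comp (eC : Fin l ≃o C) (eB : Fin m ≃o B) (eA : Fin n ≃o A) (f : B → A)
    (w : C → B) :
    chainWord eC eA (f ∘ w) = wordSubst (chainWord eB eA f) (chainWord eC eB w) := by
  apply List.ext_getElem <;> simp [chainWord, wordSubst]

theorem IsRigidSurjection.rigidWord_chainWord [Finite A] [Finite B] (eA : Fin n ≃o A)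
    (eB : Fin m ≃o B) {f : A → B} (hf : IsRigidSurjection inferInstance inferInstance f) :
    RigidWord (chainWord eA eB f) m := by
  obtain ⟨hs, hf⟩ := isRigidSurjection_iff.1 hf
  have hmem : ∀ c, c ∈ chainWord eA eB f ↔ c < m := by
    intro c
    rw [chainWord, List.mem_ofFn']
    constructor
    · rintro ⟨i, rfl⟩
      exact Fin.is_lt _
    · intro hc
      obtain ⟨a, ha⟩ := hs (eB ⟨c, hc⟩)
      exact ⟨eA.symm a, by simp [ha]⟩
  obtain ⟨b, hb⟩ : ∃ b, RigidWord (chainWord eA eB f) b := by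
    refine RigidWord.exists_of_forall_append fun p c z hp d hd => ?_
    have hpn : p.length < n := by
      rw [← length_chainWord eA eB f, hp]
      simp
    have hget : ∀ i (hi : i < n), (chainWord eA eB f)[i]'(by simpa using hi) =
        eB.symm (f (eA ⟨i, hi⟩)) := by simp [chainWord]
    have hc : c = eB.symm (f (eA ⟨p.length, hpn⟩)) := by
      rw [← hget]
      simp [hp]
    have hdm : d < m := hd.trans (hc ▸ Fin.is_lt _)
    obtain ⟨a, ha, had⟩ := hf (eA ⟨p.length, hpn⟩) (eB ⟨d, hdm⟩) (by
      rw [← eB.lt_symm_apply, Fin.lt_def, ← hc]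
      exact hd)
    rw [← eA.symm_apply_lt, Fin.lt_def] at ha
    have h1 := hget _ (eA.symm a).2
    simp only [Fin.eta, OrderIso.apply_symm_apply, had, OrderIso.symm_apply_apply] at h1
    rw [← h1]
    simp only [hp, List.getElem_append_left ha]
    exact List.getElem_mem _
  have : b = m := eq_of_forall_lt_iff fun c => (hb.mem_iff c).symm.trans (hmem c)
  exact this ▸ hb

theorem RigidWord.exists_isRigidSurjection [Finite A] [Finite B] {w : List ℕ}
    (hw : RigidWord w m) (eA : Fin n ≃o A) (eB : Fin m ≃o B) (hn : w.length = n) :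
    ∃ f : A → B, IsRigidSurjection inferInstance inferInstance f ∧ chainWord eA eB f = w := by
  subst hn
  refine ⟨fun x => eB ⟨w[eA.symm x], hw.lt_of_mem _ (List.getElem_mem _)⟩,
    isRigidSurjection_iff.2 ⟨fun y => ?_, fun a b hb => ?_⟩, ?_⟩
  · obtain ⟨i, hi, hiy⟩ := List.getElem_of_mem ((hw.mem_iff _).2 (eB.symm y).2)
    exact ⟨eA ⟨i, hi⟩, by simp [hiy]⟩
  · rw [← eB.symm_apply_lt, Fin.lt_def] at hb
    obtain ⟨i, hi, hib⟩ := hw.exists_lt_getElem_eq _ hb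
    refine ⟨eA ⟨i, hi.trans (Fin.is_lt _)⟩, ?_, ?_⟩
    · rwa [← eA.lt_symm_apply, Fin.lt_def]
    · simp [hib]
  · apply List.ext_getElem <;> simp [chainWord]

end chainWord

/-! ### Dual Ramsey theorem for chains, single and product form -/

/-- The dual Ramsey theorem for finite chains and rigid surjections. -/
theorem exists_chain_dual_ramsey (κ : Type v) [Finite κ] [Nonempty κ] (A B : Type u) [Finite A]
    [Finite B] [ordA : LinearOrder A] [ordB : LinearOrder B] :
    ∃ n : ℕ, ∀ χ : (ULift.{u} (Fin n) → A) → κ, ∃ w : ULift.{u} (Fin n) → B,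
      IsRigidSurjection inferInstance ordB w ∧
      ∃ c, ∀ f : B → A, IsRigidSurjection ordB ordA f → χ (f ∘ w) = c := by
  cases nonempty_fintype A
  cases nonempty_fintype B
  let eA := Fintype.orderIsoFinOfCardEq A rfl
  let eB := Fintype.orderIsoFinOfCardEq B rfl
  obtain ⟨n, hn⟩ := wordRamsey κ (Fintype.card A) (Fintype.card B)
  let eC : Fin n ≃o ULift.{u} (Fin n) := ⟨Equiv.ulift.symm, Iff.rfl⟩
  refine ⟨n, fun χ => ?_⟩
  obtain ⟨w, hwn, hw, c, hc⟩ :=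
    -- Words that encode no map get an arbitrary color; only encoded composites are evaluated.
    hn (Function.extend (chainWord eC eA) χ fun _ => Classical.arbitrary κ)
  obtain ⟨W, hW, rfl⟩ := hw.exists_isRigidSurjection eC eB hwn
  refine ⟨W, hW, c, fun f hf => ?_⟩
  rw [← hc _ (length_chainWord eB eA f) (hf.rigidWord_chainWord eB eA), ← chainWord_comp,
    (chainWord_injective eC eA).extend_apply]

/-- The product form of the dual Ramsey theorem for finite chains. -/
theorem exists_chain_dual_ramsey_prod (κ : Type v) [Finite κ] [Nonempty κ] {A B : Type u}
    [Finite A] [Finite B] (ordA₁ ordA₂ : LinearOrder A) (ordB₁ ordB₂ : LinearOrder B) :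
    ∃ m n : ℕ, ∀ χ : (ULift.{u} (Fin m) → A) → (ULift.{u} (Fin n) → A) → κ,
      ∃ (w₁ : ULift.{u} (Fin m) → B) (w₂ : ULift.{u} (Fin n) → B),
        IsRigidSurjection inferInstance ordB₁ w₁ ∧ IsRigidSurjection inferInstance ordB₂ w₂ ∧
        ∃ c, ∀ f₁ f₂ : B → A, IsRigidSurjection ordB₁ ordA₁ f₁ →
          IsRigidSurjection ordB₂ ordA₂ f₂ → χ (f₁ ∘ w₁) (f₂ ∘ w₂) = c := by
  obtain ⟨n, hn⟩ := exists_chain_dual_ramsey κ A B (ordA := ordA₂) (ordB := ordB₂)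
  obtain ⟨m, hm⟩ := exists_chain_dual_ramsey ((ULift.{u} (Fin n) → A) → κ) A B
    (ordA := ordA₁) (ordB := ordB₁)
  refine ⟨m, n, fun χ => ?_⟩
  obtain ⟨w₁, hw₁, χ', hχ'⟩ := hm χ
  obtain ⟨w₂, hw₂, c, hc⟩ := hn χ'
  refine ⟨w₁, w₂, hw₁, hw₂, c, fun f₁ f₂ h₁ h₂ => ?_⟩
  rw [hχ' f₁ h₁, hc f₂ h₂]

/-! ### Sums of chains as permutations, and the main theorem -/

section sum

variable {C₁ C₂ A : Type u} [Finite C₁] [Finite C₂] [Finite A] [ordC₁ : LinearOrder C₁]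
  [ordC₂ : LinearOrder C₂]

/-- The linear order on a disjoint sum in which the left summand comes first. -/
abbrev sumOrderLeft (C₁ C₂ : Type u) [LinearOrder C₁] [LinearOrder C₂] : LinearOrder (C₁ ⊕ C₂) :=
  LinearOrder.lift' (toLex : C₁ ⊕ C₂ → Lex (C₁ ⊕ C₂)) toLex.injective

/-- The linear order on a disjoint sum in which the right summand comes first. -/
abbrev sumOrderRight (C₁ C₂ : Type u) [LinearOrder C₁] [LinearOrder C₂] : LinearOrder (C₁ ⊕ C₂) :=
  LinearOrder.lift' (fun x : C₁ ⊕ C₂ => (toLex x.swap : Lex (C₂ ⊕ C₁)))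
    (toLex.injective.comp Sum.swap_leftInverse.injective)

theorem IsRigidSurjection.sum_elim_left {ordA : LinearOrder A} {f : C₁ → A}
    (hf : IsRigidSurjection ordC₁ ordA f) (g : C₂ → A) :
    IsRigidSurjection (sumOrderLeft C₁ C₂) ordA (Sum.elim f g) := by
  let := sumOrderLeft C₁ C₂
  obtain ⟨hs, hf⟩ := isRigidSurjection_iff.1 hf
  refine isRigidSurjection_iff.2 ⟨fun y => ?_, ?_⟩
  · obtain ⟨x, hx⟩ := hs y
    exact ⟨Sum.inl x, hx⟩
  · rintro (x | x) y hy
    · obtain ⟨x', hx', h⟩ := hf x y hy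
      exact ⟨Sum.inl x', Sum.Lex.inl_lt_inl_iff.2 hx', h⟩
    · obtain ⟨x', h⟩ := hs y
      exact ⟨Sum.inl x', Sum.Lex.inl_lt_inr _ _, h⟩

theorem IsRigidSurjection.sum_elim_right {ordA : LinearOrder A} {g : C₂ → A}
    (hg : IsRigidSurjection ordC₂ ordA g) (f : C₁ → A) :
    IsRigidSurjection (sumOrderRight C₁ C₂) ordA (Sum.elim f g) := by
  let := sumOrderRight C₁ C₂
  obtain ⟨hs, hg⟩ := isRigidSurjection_iff.1 hg
  refine isRigidSurjection_iff.2 ⟨fun y => ?_, ?_⟩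
  · obtain ⟨x, hx⟩ := hs y
    exact ⟨Sum.inr x, hx⟩
  · rintro (x | x) y hy
    · obtain ⟨x', h⟩ := hs y
      exact ⟨Sum.inr x', Sum.Lex.inl_lt_inr _ _, h⟩
    · obtain ⟨x', hx', h⟩ := hg x y hy
      exact ⟨Sum.inr x', Sum.Lex.inl_lt_inl_iff.2 hx', h⟩

end sum

namespace PermQuo

/-- The disjoint sum of two chains, with the first chain first in the first order and the second
chain first in the second order. -/
def ofChains (C₁ C₂ : Type u) [Finite C₁] [Finite C₂] [LinearOrder C₁] [LinearOrder C₂] :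
    PermQuo.{u} where
  carrier := C₁ ⊕ C₂
  finite := inferInstance
  ord₁ := sumOrderLeft C₁ C₂
  ord₂ := sumOrderRight C₁ C₂

/-- The quotient map determined by a pair of rigid surjections. -/
def homOfChains {C₁ C₂ : Type u} [Finite C₁] [Finite C₂] [ordC₁ : LinearOrder C₁]
    [ordC₂ : LinearOrder C₂] {A : PermQuo.{u}} {f : C₁ → A.carrier} {g : C₂ → A.carrier}
    (hf : IsRigidSurjection ordC₁ A.ord₁ f) (hg : IsRigidSurjection ordC₂ A.ord₂ g) :
    ofChains C₁ C₂ ⟶ A :=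
  Hom.mk (A := ofChains C₁ C₂) (Sum.elim f g) (hf.sum_elim_left g) (hg.sum_elim_right f)

theorem homOfChains_comp {C₁ C₂ : Type u} [Finite C₁] [Finite C₂] [ordC₁ : LinearOrder C₁]
    [ordC₂ : LinearOrder C₂] {A B : PermQuo.{u}} {w₁ : C₁ → B.carrier} {w₂ : C₂ → B.carrier}
    (hw₁ : IsRigidSurjection ordC₁ B.ord₁ w₁) (hw₂ : IsRigidSurjection ordC₂ B.ord₂ w₂)
    (f : B ⟶ A) :
    homOfChains hw₁ hw₂ ≫ f = homOfChains (f.rigid₁.comp hw₁) (f.rigid₂.comp hw₂) := by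
  refine Hom.ext (funext ?_)
  rintro (x | x) <;> rfl

end PermQuo

theorem mainTheorem1 : HasDualRamseyProperty PermQuo.{u} := by
  classical
  intro k hk X Y
  have : Nonempty (Fin k) := ⟨⟨0, by omega⟩⟩
  obtain ⟨m, n, h⟩ := exists_chain_dual_ramsey_prod (Fin k) X.unop.ord₁ X.unop.ord₂
    Y.unop.ord₁ Y.unop.ord₂
  refine ⟨Opposite.op (PermQuo.ofChains (ULift.{u} (Fin m)) (ULift.{u} (Fin n))), fun P hP => ?_⟩
  have hcol : ∀ f, ∃ i, f ∈ P i := fun f => Set.mem_iUnion.1 (hP.1 ▸ Set.mem_univ f)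
  choose col hcol using hcol
  -- A rigid pair gets the color of its glued quotient map. The default color never matters, as
  -- composites of rigid surjections are rigid.
  obtain ⟨w₁, w₂, hw₁, hw₂, c, hc⟩ := h fun f₁ f₂ =>
    if hf : IsRigidSurjection inferInstance X.unop.ord₁ f₁ ∧
        IsRigidSurjection inferInstance X.unop.ord₂ f₂ then
      col (PermQuo.homOfChains hf.1 hf.2).op
    else Classical.arbitrary _
  refine ⟨c, (PermQuo.homOfChains hw₁ hw₂).op, ?_⟩
  rintro _ ⟨f, rfl⟩
  have hf := hc f.unop.toFun f.unop.toFun f.unop.rigid₁ f.unop.rigid₂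
  rw [dif_pos ⟨f.unop.rigid₁.comp hw₁, f.unop.rigid₂.comp hw₂⟩] at hf
  beta_reduce
  rw [← hf, show f ≫ (PermQuo.homOfChains hw₁ hw₂).op = _ from
    congrArg Quiver.Hom.op (PermQuo.homOfChains_comp hw₁ hw₂ f.unop)]
  exact hcol _
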